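/- Let $m, n, r$ be integers with $r \ge 1$ and put $N = \min(m,n)$. On real $m\times n$ matrices use the scalar product $\langle X, Y\rangle = \mathrm{tr}(X^T Y)$ and the Frobenius norm $\|X\|_F = \sqrt{\langle X, X\rangle}$. For a matrix $Z$ let $z_1 \ge z_2 \ge \dots \ge z_N \ge 0$ be its singular values (with $z_{N+1} = 0$). Define $$\mathcal{R}_r(X) = \max_{Z \in \mathbb{R}^{m\times n}} \left( \sum_{i=r+1}^{N} z_i^2 - \|X - Z\|_F^2 \right), \qquad G(X) = \mathcal{R}_r(X) + \|X\|_F^2,$$ and let $\partial G(X)$ be the subdifferential of the convex function $G$ at $X$, that is, the set of all $S \in \mathbb{R}^{m\times n}$ with $G(Y) \ge G(X) + \langle S, Y - X\rangle$ for all $Y \in \mathbb{R}^{m \times n}$. Let $X \in \mathbb{R}^{m\times n}$ have rank $r$, let $2Z \in \partial G(X)$, and suppose that the singular values of $Z$ satisfy $z_{r+1} < c\, z_r$ for some $0 < c < 1$. Then for every $X' \in \mathbb{R}^{m\times n}$ with $X' \ne X$ and $\mathrm{rank}(X') \le r$ and every $Z'$ with $2Z' \in \partial G(X')$, $$\langle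 Z' - Z, X' - X\rangle > \frac{1-c}{2}\, \|X' - X\|_F^2 .$$ -/

import Mathlib

noncomputable section

namespace FixedRank

variable {m n : ℕ}

/-- The scalar product `⟨X, Y⟩ = tr (Xᵀ Y)` of real `m × n` matrices. -/
def inn (X Y : Matrix (Fin m) (Fin n) ℝ) : ℝ := (X.transpose * Y).trace

/-- The Frobenius norm `‖X‖_F = √⟨X, X⟩`. -/
def fnorm (X : Matrix (Fin m) (Fin n) ℝ) : ℝ := Real.sqrt (inn X X)

/-- The `i`-th singular value of `Z`, in non-increasing order and for `i = 1, 2, …`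
(Mathlib's sequence starts at index `0`); it is `0` for `i > min m n`.
The value at `i = 0` has no meaning and is never used. -/
def sv (Z : Matrix (Fin m) (Fin n) ℝ) (i : ℕ) : ℝ :=
  (Matrix.toLpLin 2 2 Z).singularValues (i - 1)

/-- The regularizer `R_r(X) = sup_Z (∑_{i=r+1}^N z_i² - ‖X - Z‖_F²)` with `N = min m n`, where the
`z_i` are the singular values of `Z`. For `1 ≤ r` the supremum is that of a bounded set
(`bddAbove_reg`). -/
def reg (r : ℕ) (X : Matrix (Fin m) (Fin n) ℝ) : ℝ :=
  ⨆ Z : Matrix (Fin m) (Fin n) ℝ,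
    (∑ i ∈ Finset.Icc (r + 1) (min m n), sv Z i ^ 2) - fnorm (X - Z) ^ 2

/-- The function `G(X) = R_r(X) + ‖X‖_F²`. -/
def G (r : ℕ) (X : Matrix (Fin m) (Fin n) ℝ) : ℝ := reg r X + fnorm X ^ 2

/-- The set of subgradients at `X` (in the sense of convex analysis, with respect to
`⟨X, Y⟩ = tr (Xᵀ Y)`) of a function on matrices. -/
def subdiff (f : Matrix (Fin m) (Fin n) ℝ → ℝ) (X : Matrix (Fin m) (Fin n) ℝ) :
    Set (Matrix (Fin m) (Fin n) ℝ) :=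
  {S | ∀ Y, f X + inn S (Y - X) ≤ f Y}

lemma inn_eq_sum (X Y : Matrix (Fin m) (Fin n) ℝ) : inn X Y = ∑ j, ∑ i, X i j * Y i j := by
  simp [inn, Matrix.trace, Matrix.mul_apply]

lemma inn_self_nonneg (X : Matrix (Fin m) (Fin n) ℝ) : 0 ≤ inn X X := by
  rw [inn_eq_sum]
  exact Finset.sum_nonneg fun j _ => Finset.sum_nonneg fun i _ => mul_self_nonneg _

lemma fnorm_sq (X : Matrix (Fin m) (Fin n) ℝ) : fnorm X ^ 2 = inn X X :=
  Real.sq_sqrt (inn_self_nonneg X)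

/-- The squares of the singular values sum to `‖Z‖_F²`. -/
lemma sum_sv_sq (Z : Matrix (Fin m) (Fin n) ℝ) :
    ∑ i ∈ Finset.range n, (Matrix.toLpLin 2 2 Z).singularValues i ^ 2 = inn Z Z := by
  set T := Matrix.toLpLin 2 2 Z with hT
  have hn : Module.finrank ℝ (EuclideanSpace ℝ (Fin n)) = n := by simp
  rw [Finset.sum_range]
  have h1 : ∀ i : Fin n, T.singularValues i ^ 2
      = T.isSymmetric_adjoint_comp_self.eigenvalues hn i := fun i => T.sq_singularValues_fin hn i
  simp_rw [h1]
  have h2 := T.isSymmetric_adjoint_comp_self.trace_eq_sum_eigenvalues hn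
  simp only [RCLike.ofReal_real_eq_id, id_eq] at h2
  rw [← h2, LinearMap.trace_eq_sum_inner _ (EuclideanSpace.basisFun (Fin n) ℝ), inn_eq_sum]
  refine Finset.sum_congr rfl fun j _ => ?_
  rw [LinearMap.comp_apply, LinearMap.adjoint_inner_right, PiLp.inner_apply]
  refine Finset.sum_congr rfl fun i _ => ?_
  simp [hT, Matrix.toLpLin_apply, sq]

/-- The supremum that defines `reg r X` is that of a bounded set. -/
lemma bddAbove_reg {r : ℕ} (hr : 1 ≤ r) (X : Matrix (Fin m) (Fin n) ℝ) :
    BddAbove (Set.range fun Z : Matrix (Fin m) (Fin n) ℝ =>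
      (∑ i ∈ Finset.Icc (r + 1) (min m n), sv Z i ^ 2) - fnorm (X - Z) ^ 2) := by
  refine ⟨n * inn X X, ?_⟩
  rintro _ ⟨Z, rfl⟩
  rcases Nat.eq_zero_or_pos n with rfl | hn
  · simp [fnorm, inn]
  have hn1 : (1 : ℝ) ≤ n := by exact_mod_cast hn
  have h0 : (Finset.Icc (r + 1) (min m n)).sum (fun i => sv Z i ^ 2) + sv Z 1 ^ 2 ≤ inn Z Z := by
    have hs : ∀ f : ℕ → ℝ, ∑ i ∈ Finset.range n, f i
        = (∑ i ∈ Finset.range n.pred, f (i + 1)) + f 0 := fun f => by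
      rw [← Finset.sum_range_succ', ← Nat.succ_eq_add_one, Nat.succ_pred_eq_of_pos hn]
    rw [← sum_sv_sq, hs]
    refine add_le_add ?_ (le_of_eq rfl)
    change _ ≤ ∑ k ∈ Finset.range n.pred, sv Z (k + 2) ^ 2
    rw [← Finset.sum_image (s := Finset.range n.pred) (g := fun k => k + 2)
      (f := fun i => sv Z i ^ 2) (by intro a _ b _ h; simpa using h)]
    refine Finset.sum_le_sum_of_subset_of_nonneg ?_ fun _ _ _ => sq_nonneg _
    intro i hi
    simp only [Finset.mem_Icc, Finset.mem_image, Finset.mem_range, Nat.pred_eq_sub_one] at hi ⊢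
    exact ⟨i - 2, by omega, by omega⟩
  have h1 : inn Z Z ≤ n * sv Z 1 ^ 2 := by
    rw [← sum_sv_sq]
    calc _ ≤ ∑ _i ∈ Finset.range n, sv Z 1 ^ 2 := by
          refine Finset.sum_le_sum fun i _ => ?_
          exact pow_le_pow_left₀ (LinearMap.singularValues_nonneg _ _)
            (LinearMap.singularValues_antitone _ (Nat.zero_le i)) 2
      _ = _ := by simp
  have h2 := inn_self_nonneg ((n : ℝ) • X - Z)
  have h3 : inn ((n : ℝ) • X - Z) ((n : ℝ) • X - Z)
      = n ^ 2 * inn X X - 2 * n * inn X Z + inn Z Z := by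
    simp only [inn_eq_sum, Finset.mul_sum, ← Finset.sum_add_distrib, ← Finset.sum_sub_distrib]
    refine Finset.sum_congr rfl fun j _ => Finset.sum_congr rfl fun i _ => ?_
    simp only [Matrix.sub_apply, Matrix.smul_apply, smul_eq_mul]
    ring
  have h4 : inn (X - Z) (X - Z) = inn X X - 2 * inn X Z + inn Z Z := by
    simp only [inn_eq_sum, Finset.mul_sum, ← Finset.sum_add_distrib, ← Finset.sum_sub_distrib]
    refine Finset.sum_congr rfl fun j _ => Finset.sum_congr rfl fun i _ => ?_
    simp only [Matrix.sub_apply]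
    ring
  have h5 := inn_self_nonneg X
  simp only [fnorm_sq, h4]
  have h6 : 0 ≤ (n : ℝ) * (n * inn X X - 2 * inn X Z + sv Z 1 ^ 2) := by nlinarith
  have h7 := nonneg_of_mul_nonneg_right h6 (by linarith)
  linarith

end FixedRank

end

/-!
On matrices of rank at most `r` the regularizer `reg r` vanishes: it is nonnegative (test `Z = X`)
and the Eckart–Young theorem bounds it above by `0`. So there `G` is the squared Frobenius norm, and
testing `2Z ∈ ∂G(X)` on matrices `Y` of rank at most `r` says that `X` is a best approximation of
`Z` of rank at most `r`, or equivalently `2⟨Z - X, Y - X⟩ ≤ ‖Y - X‖²` (`two_mul_inn_sub_le`).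

Under the gap `z_{r+1} < z_r` this best approximation is unique, so `X` is the truncated singular
value decomposition of `Z`. If moreover `z_{r+1} ≤ q z_r`, then dividing the discarded singular
values by `q` leaves `X` a best approximation, of `X + q⁻¹(Z - X)` instead of `Z`; this improves the
estimate to `2⟨Z - X, Y - X⟩ ≤ q‖Y - X‖²` (`two_mul_inn_sub_le_mul`).

Finally
`⟨Z' - Z, X' - X⟩ = ‖X' - X‖² - ⟨Z' - X', X - X'⟩ - ⟨Z - X, X' - X⟩ ≥ (1 - 1/2 - q/2)‖X' - X‖²`,
and some `q < c` is admissible.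

The Eckart–Young theorem and its uniqueness part are proved for linear maps, in an orthonormal basis
of right singular vectors `u_i`: for `Y` with kernel projection `P`, the squared distance from `T` to
`Y` is at least `∑ ‖P u_i‖² ‖T u_i‖²` (`sum_norm_sq_sub_eq`), where the weights `‖P u_i‖²` lie in
`[0, 1]` and have sum `dim (ker Y)`.
-/

namespace FixedRank

open Module
open scoped InnerProductSpace

/-! ### Best approximation of linear maps by maps of bounded rank -/

section LinearMaps

variable {ι E F : Type*} [Fintype ι]
  [NormedAddCommGroup E] [InnerProductSpace ℝ E]
  [NormedAddCommGroup F] [InnerProductSpace ℝ F]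

/-- If `T` maps the orthonormal basis `u` to pairwise orthogonal vectors, i.e. `u` consists of right
singular vectors of `T`, then `T` acts diagonally on squared norms. -/
lemma norm_sq_apply_eq_sum (u : OrthonormalBasis ι ℝ E) {T : E →ₗ[ℝ] F}
    (hT : Pairwise fun i j => ⟪T (u i), T (u j)⟫_ℝ = 0) (x : E) :
    ‖T x‖ ^ 2 = ∑ j, ⟪u j, x⟫_ℝ ^ 2 * ‖T (u j)‖ ^ 2 := by
  conv_lhs => rw [← u.sum_repr' x]
  rw [← real_inner_self_eq_norm_sq, map_sum, sum_inner]
  refine Finset.sum_congr rfl fun i _ => ?_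
  rw [inner_sum, Finset.sum_eq_single i]
  · rw [map_smul, real_inner_smul_left, real_inner_smul_right, real_inner_self_eq_norm_sq]
    ring
  · intro j _ hj
    rw [map_smul, map_smul, real_inner_smul_left, real_inner_smul_right, hT hj.symm]
    ring
  · simp

section Truncation

variable [DecidableEq ι]

/-- The map that agrees with `T` on the basis vectors `u i`, `i ∈ S`, and vanishes on the others.
For `u` a basis of right singular vectors this is a truncated singular value decomposition. -/
noncomputable def truncate (u : OrthonormalBasis ι ℝ E) (T : E →ₗ[ℝ] F) (S : Finset ι) : E →ₗ[ℝ] F :=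
  u.toBasis.constr ℝ fun i => if i ∈ S then T (u i) else 0

lemma truncate_apply (u : OrthonormalBasis ι ℝ E) (T : E →ₗ[ℝ] F) (S : Finset ι) (i : ι) :
    truncate u T S (u i) = if i ∈ S then T (u i) else 0 := by
  have h := u.toBasis.constr_basis ℝ (fun i => if i ∈ S then T (u i) else 0) i
  rwa [u.coe_toBasis] at h

lemma finrank_range_truncate_le (u : OrthonormalBasis ι ℝ E) (T : E →ₗ[ℝ] F) (S : Finset ι) :
    finrank ℝ (LinearMap.range (truncate u T S)) ≤ S.card := by
  classical
  have h : LinearMap.range (truncate u T S)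
      ≤ Submodule.span ℝ ((S.image fun i => T (u i) : Finset F) : Set F) := by
    rw [truncate, Basis.constr_range, Submodule.span_le]
    rintro _ ⟨i, rfl⟩
    dsimp only
    split_ifs with hi
    · exact Submodule.subset_span (Finset.mem_coe.2 (Finset.mem_image_of_mem _ hi))
    · exact zero_mem _
  exact (Submodule.finrank_mono h).trans ((finrank_span_finset_le_card _).trans Finset.card_image_le)

lemma sum_norm_sq_truncate_sub (u : OrthonormalBasis ι ℝ E) (T : E →ₗ[ℝ] F) (S : Finset ι) :
    ∑ i, ‖(truncate u T S - T) (u i)‖ ^ 2 = ∑ i ∈ Sᶜ, ‖T (u i)‖ ^ 2 := by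
  rw [← Finset.sum_add_sum_compl S, Finset.sum_eq_zero, zero_add]
  · refine Finset.sum_congr rfl fun i hi => ?_
    rw [LinearMap.sub_apply, truncate_apply, if_neg (Finset.mem_compl.1 hi), zero_sub, norm_neg]
  · intro i hi
    rw [LinearMap.sub_apply, truncate_apply, if_pos hi, sub_self, norm_zero, sq, zero_mul]

end Truncation

variable [FiniteDimensional ℝ E]

lemma sum_norm_sq_starProjection (u : OrthonormalBasis ι ℝ E) (K : Submodule ℝ E) :
    ∑ i, ‖K.starProjection (u i)‖ ^ 2 = finrank ℝ K := by
  have hK : LinearMap.IsProj K (K.starProjection : E →ₗ[ℝ] E) :=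
    ⟨fun x => K.starProjection_apply_mem x,
      fun x hx => Submodule.starProjection_eq_self_iff.2 hx⟩
  rw [← hK.trace, LinearMap.trace_eq_sum_inner _ u]
  refine Finset.sum_congr rfl fun i _ => ?_
  have h := K.re_inner_starProjection_eq_normSq (u i)
  rw [real_inner_comm]
  exact h.symm

lemma sum_norm_sq_apply_starProjection (u : OrthonormalBasis ι ℝ E) {T : E →ₗ[ℝ] F}
    (hT : Pairwise fun i j => ⟪T (u i), T (u j)⟫_ℝ = 0) (K : Submodule ℝ E) :
    ∑ i, ‖T (K.starProjection (u i))‖ ^ 2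
      = ∑ i, ‖K.starProjection (u i)‖ ^ 2 * ‖T (u i)‖ ^ 2 := by
  simp_rw [norm_sq_apply_eq_sum u hT (K.starProjection (u _))]
  rw [Finset.sum_comm]
  refine Finset.sum_congr rfl fun j _ => ?_
  rw [← Finset.sum_mul, ← u.sum_sq_norm_inner_right]
  congr 1
  refine Finset.sum_congr rfl fun i _ => ?_
  rw [← K.inner_starProjection_left_eq_right, real_inner_comm, Real.norm_eq_abs, sq_abs]

lemma norm_sq_starProjection_le_one (u : OrthonormalBasis ι ℝ E) (K : Submodule ℝ E) (i : ι) :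
    ‖K.starProjection (u i)‖ ^ 2 ≤ 1 := by
  have h := K.norm_starProjection_apply_le (u i)
  rw [u.norm_eq_one] at h
  exact pow_le_one₀ (norm_nonneg _) h

section Compl

variable [DecidableEq ι]

/-- The weights `‖P u_i‖²` of the projection onto `ker Y` sum to `dim (ker Y)`, hence to at least
`#Sᶜ` when `Y` has rank at most `#S`; what they lack from `1` off `S` is made up on `S`. -/
lemma sum_compl_one_sub_le (u : OrthonormalBasis ι ℝ E) {Y : E →ₗ[ℝ] F} {S : Finset ι}
    (hY : finrank ℝ (LinearMap.range Y) ≤ S.card) :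
    ∑ i ∈ Sᶜ, (1 - ‖(LinearMap.ker Y).starProjection (u i)‖ ^ 2)
      ≤ ∑ i ∈ S, ‖(LinearMap.ker Y).starProjection (u i)‖ ^ 2 := by
  have h1 := sum_norm_sq_starProjection u (LinearMap.ker Y)
  have h2 := LinearMap.finrank_range_add_finrank_ker Y
  rw [finrank_eq_card_basis u.toBasis, ← Finset.card_add_card_compl S] at h2
  have h3 : ((Sᶜ).card : ℝ) ≤ finrank ℝ (LinearMap.ker Y) := by exact_mod_cast (by omega)
  rw [← Finset.sum_add_sum_compl S] at h1
  rw [Finset.sum_sub_distrib, Finset.sum_const, nsmul_eq_mul, mul_one]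
  linarith

/-- Moving projection weight from `Sᶜ`, where the squared singular values are at most `b`, to `S`, where
they are at least `a`, increases the weighted sum by at least `a - b` per unit. -/
lemma sum_compl_add_le (u : OrthonormalBasis ι ℝ E) {T Y : E →ₗ[ℝ] F} {S : Finset ι}
    (hY : finrank ℝ (LinearMap.range Y) ≤ S.card) {a b : ℝ} (hb : 0 ≤ b)
    (ha : ∀ i ∈ S, a ≤ ‖T (u i)‖ ^ 2) (hb' : ∀ i ∈ Sᶜ, ‖T (u i)‖ ^ 2 ≤ b) :
    ∑ i ∈ Sᶜ, ‖T (u i)‖ ^ 2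
        + (a - b) * ∑ i ∈ S, ‖(LinearMap.ker Y).starProjection (u i)‖ ^ 2
      ≤ ∑ i, ‖(LinearMap.ker Y).starProjection (u i)‖ ^ 2 * ‖T (u i)‖ ^ 2 := by
  have h1 := mul_le_mul_of_nonneg_left (sum_compl_one_sub_le u hY) hb
  have h2 : a * ∑ i ∈ S, ‖(LinearMap.ker Y).starProjection (u i)‖ ^ 2
      ≤ ∑ i ∈ S, ‖(LinearMap.ker Y).starProjection (u i)‖ ^ 2 * ‖T (u i)‖ ^ 2 := by
    rw [Finset.mul_sum]
    refine Finset.sum_le_sum fun i hi => ?_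
    rw [mul_comm]
    exact mul_le_mul_of_nonneg_left (ha i hi) (sq_nonneg _)
  have h3 : ∑ i ∈ Sᶜ, ‖T (u i)‖ ^ 2
      ≤ ∑ i ∈ Sᶜ, ‖(LinearMap.ker Y).starProjection (u i)‖ ^ 2 * ‖T (u i)‖ ^ 2
        + b * ∑ i ∈ Sᶜ, (1 - ‖(LinearMap.ker Y).starProjection (u i)‖ ^ 2) := by
    rw [Finset.mul_sum, ← Finset.sum_add_distrib]
    refine Finset.sum_le_sum fun i hi => ?_
    have := mul_le_mul_of_nonneg_right (hb' i hi)
      (sub_nonneg.2 (norm_sq_starProjection_le_one u (LinearMap.ker Y) i))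
    linarith
  rw [← Finset.sum_add_sum_compl S]
  linarith

end Compl

variable [FiniteDimensional ℝ F]

lemma sum_inner_eq_trace (u : OrthonormalBasis ι ℝ E) (A B : E →ₗ[ℝ] F) :
    ∑ i, ⟪A (u i), B (u i)⟫_ℝ = LinearMap.trace ℝ E (A.adjoint ∘ₗ B) := by
  rw [LinearMap.trace_eq_sum_inner _ u]
  simp [LinearMap.adjoint_inner_right]

/-- Pythagoras for the Hilbert–Schmidt norm, splitting the domain into `K` and `Kᗮ`. -/
lemma sum_norm_sq_eq_add (u : OrthonormalBasis ι ℝ E) (D : E →ₗ[ℝ] F) (K : Submodule ℝ E) :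
    ∑ i, ‖D (u i)‖ ^ 2 = ∑ i, ‖D (u i - K.starProjection (u i))‖ ^ 2
      + ∑ i, ‖D (K.starProjection (u i))‖ ^ 2 := by
  set Q : E →ₗ[ℝ] E := K.starProjection.toLinearMap with hQ
  have hQs : Q.adjoint = Q := (LinearMap.isSymmetric_iff_isSelfAdjoint Q).1
    K.starProjection_isSymmetric
  have hQQ : Q * Q = Q := by
    ext x
    exact congrArg (fun f : E →L[ℝ] E => f x) K.isIdempotentElem_starProjection
  have hcross : ∑ i, ⟪(D ∘ₗ (1 - Q)) (u i), (D ∘ₗ Q) (u i)⟫_ℝ = 0 := by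
    rw [sum_inner_eq_trace, LinearMap.adjoint_comp]
    have h1 : (1 - Q).adjoint = 1 - Q := by
      rw [map_sub, hQs]
      congr 1
      exact LinearMap.adjoint_id
    have h2 : ((1 - Q).adjoint ∘ₗ D.adjoint) ∘ₗ D ∘ₗ Q
        = (1 - Q) * ((D.adjoint ∘ₗ D) * Q) := by
      rw [h1]
      rfl
    rw [h2, LinearMap.trace_mul_comm, mul_assoc, mul_sub, mul_one, hQQ, sub_self, mul_zero,
      map_zero]
  have hi : ∀ i, ‖D (u i)‖ ^ 2 = ‖D (u i - Q (u i))‖ ^ 2 + ‖D (Q (u i))‖ ^ 2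
      + 2 * ⟪(D ∘ₗ (1 - Q)) (u i), (D ∘ₗ Q) (u i)⟫_ℝ := fun i => by
    have : D (u i) = D (u i - Q (u i)) + D (Q (u i)) := by simp
    rw [this, norm_add_sq_real]
    simp only [LinearMap.comp_apply, LinearMap.sub_apply, Module.End.one_apply]
    ring
  calc _ = ∑ i, (‖D (u i - Q (u i))‖ ^ 2 + ‖D (Q (u i))‖ ^ 2
      + 2 * ⟪(D ∘ₗ (1 - Q)) (u i), (D ∘ₗ Q) (u i)⟫_ℝ) := Finset.sum_congr rfl fun i _ => hi i
    _ = _ := by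
      rw [Finset.sum_add_distrib, Finset.sum_add_distrib, ← Finset.mul_sum, hcross, mul_zero,
        add_zero]
      rfl

/-- The distance from `T` to `Y` splits into a part on `(ker Y)ᗮ` and a weighted sum of the squared
singular values of `T` that depends on `Y` only through its kernel. -/
lemma sum_norm_sq_sub_eq (u : OrthonormalBasis ι ℝ E) {T : E →ₗ[ℝ] F}
    (hT : Pairwise fun i j => ⟪T (u i), T (u j)⟫_ℝ = 0) (Y : E →ₗ[ℝ] F) :
    ∑ i, ‖(Y - T) (u i)‖ ^ 2
      = ∑ i, ‖(Y - T) (u i - (LinearMap.ker Y).starProjection (u i))‖ ^ 2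
        + ∑ i, ‖(LinearMap.ker Y).starProjection (u i)‖ ^ 2 * ‖T (u i)‖ ^ 2 := by
  rw [sum_norm_sq_eq_add u (Y - T) (LinearMap.ker Y), ← sum_norm_sq_apply_starProjection u hT]
  congr 1
  refine Finset.sum_congr rfl fun i _ => ?_
  have h : Y ((LinearMap.ker Y).starProjection (u i)) = 0 :=
    LinearMap.mem_ker.1 (Submodule.starProjection_apply_mem _ _)
  rw [LinearMap.sub_apply, h, zero_sub, norm_neg]

variable [DecidableEq ι]

/-- The Eckart–Young lower bound. The indices in `S` need not be listed in order: it suffices that a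
threshold `t` separates the squared singular values on `S` from the others. -/
theorem sum_compl_norm_sq_le (u : OrthonormalBasis ι ℝ E) {T : E →ₗ[ℝ] F}
    (hT : Pairwise fun i j => ⟪T (u i), T (u j)⟫_ℝ = 0) {Y : E →ₗ[ℝ] F} {S : Finset ι}
    (hY : finrank ℝ (LinearMap.range Y) ≤ S.card) {t : ℝ} (ht : 0 ≤ t)
    (htS : ∀ i ∈ S, t ≤ ‖T (u i)‖ ^ 2) (htS' : ∀ i ∈ Sᶜ, ‖T (u i)‖ ^ 2 ≤ t) :
    ∑ i ∈ Sᶜ, ‖T (u i)‖ ^ 2 ≤ ∑ i, ‖(Y - T) (u i)‖ ^ 2 := by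
  have h := sum_compl_add_le u hY ht htS htS'
  rw [sub_self, zero_mul, add_zero] at h
  rw [sum_norm_sq_sub_eq u hT Y]
  exact h.trans (le_add_of_nonneg_left (Finset.sum_nonneg fun i _ => sq_nonneg _))

/-- Uniqueness in the Eckart–Young theorem: if the squared singular values on `S` are separated from the
others by a strict gap, the truncation of `T` to `S` is the only best approximation. -/
theorem apply_eq_of_sum_norm_sq_le (u : OrthonormalBasis ι ℝ E) {T : E →ₗ[ℝ] F}
    (hT : Pairwise fun i j => ⟪T (u i), T (u j)⟫_ℝ = 0) {Y : E →ₗ[ℝ] F} {S : Finset ι}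
    (hY : finrank ℝ (LinearMap.range Y) ≤ S.card) {a b : ℝ} (hb : 0 ≤ b) (hab : b < a)
    (ha : ∀ i ∈ S, a ≤ ‖T (u i)‖ ^ 2) (hb' : ∀ i ∈ Sᶜ, ‖T (u i)‖ ^ 2 ≤ b)
    (hopt : ∑ i, ‖(Y - T) (u i)‖ ^ 2 ≤ ∑ i ∈ Sᶜ, ‖T (u i)‖ ^ 2) :
    ∀ i, Y (u i) = if i ∈ S then T (u i) else 0 := by
  set K := LinearMap.ker Y with hK
  have h1 := sum_compl_add_le u hY hb ha hb'
  have h2 := sum_compl_one_sub_le u hY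
  rw [sum_norm_sq_sub_eq u hT Y, ← hK] at hopt
  rw [← hK] at h1 h2
  have h3 : 0 ≤ ∑ i, ‖(Y - T) (u i - K.starProjection (u i))‖ ^ 2 :=
    Finset.sum_nonneg fun i _ => sq_nonneg _
  have h4 : 0 ≤ ∑ i ∈ S, ‖K.starProjection (u i)‖ ^ 2 := Finset.sum_nonneg fun i _ => sq_nonneg _
  have h5 : 0 ≤ (a - b) * ∑ i ∈ S, ‖K.starProjection (u i)‖ ^ 2 :=
    mul_nonneg (by linarith) h4
  have h6 : ∑ i ∈ S, ‖K.starProjection (u i)‖ ^ 2 = 0 :=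
    (mul_eq_zero.1 (by linarith : (a - b) * ∑ i ∈ S, ‖K.starProjection (u i)‖ ^ 2 = 0)).resolve_left
      (by linarith)
  have h7 : ∑ i, ‖(Y - T) (u i - K.starProjection (u i))‖ ^ 2 = 0 := by linarith
  have h8 : ∑ i ∈ Sᶜ, (1 - ‖K.starProjection (u i)‖ ^ 2) = 0 :=
    le_antisymm (h6 ▸ h2)
      (Finset.sum_nonneg fun i _ => sub_nonneg.2 (norm_sq_starProjection_le_one u K i))
  intro i
  split_ifs with hi
  · have h9 := (Finset.sum_eq_zero_iff_of_nonneg fun i _ => sq_nonneg _).1 h6 i hi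
    have h10 := (Finset.sum_eq_zero_iff_of_nonneg fun i _ => sq_nonneg _).1 h7 i
      (Finset.mem_univ i)
    rw [sq_eq_zero_iff, norm_eq_zero] at h9 h10
    rwa [h9, sub_zero, LinearMap.sub_apply, sub_eq_zero] at h10
  · have h9 := (Finset.sum_eq_zero_iff_of_nonneg fun i _ =>
      sub_nonneg.2 (norm_sq_starProjection_le_one u K i)).1 h8 i (Finset.mem_compl.2 hi)
    refine LinearMap.mem_ker.1 ((K.mem_iff_norm_starProjection (u i)).2 ?_)
    rw [u.norm_eq_one]
    exact (pow_eq_one_iff_of_nonneg (norm_nonneg _) two_ne_zero).1 (by linarith)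

/-- Let `X` be the truncation of `T` to `S`. If the singular values off `S` are at most `q` times
those on `S`, they may be divided by `q` and `X` remains a best approximation, now of
`X + q⁻¹ • (T - X)`. Expanding this optimality against `Y` gives the estimate. -/
theorem two_mul_sum_inner_le (u : OrthonormalBasis ι ℝ E) {T X : E →ₗ[ℝ] F}
    (hT : Pairwise fun i j => ⟪T (u i), T (u j)⟫_ℝ = 0) {S : Finset ι}
    (hX : ∀ i, X (u i) = if i ∈ S then T (u i) else 0) {Y : E →ₗ[ℝ] F}
    (hY : finrank ℝ (LinearMap.range Y) ≤ S.card) {t q : ℝ} (ht : 0 ≤ t) (hq : 0 < q)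
    (htS : ∀ i ∈ S, t ≤ ‖T (u i)‖ ^ 2) (htS' : ∀ i ∈ Sᶜ, ‖T (u i)‖ ^ 2 ≤ q ^ 2 * t) :
    2 * ∑ i, ⟪(T - X) (u i), (Y - X) (u i)⟫_ℝ ≤ q * ∑ i, ‖(Y - X) (u i)‖ ^ 2 := by
  set W : E →ₗ[ℝ] F := X + q⁻¹ • (T - X) with hW
  have hWS : ∀ i ∈ S, W (u i) = T (u i) := fun i hi => by simp [hW, hX, hi]
  have hWS' : ∀ i ∈ Sᶜ, W (u i) = q⁻¹ • T (u i) := fun i hi => by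
    simp [hW, hX, Finset.mem_compl.1 hi]
  have hWc : ∀ i, ∃ s : ℝ, W (u i) = s • T (u i) := fun i => by
    by_cases hi : i ∈ S
    · exact ⟨1, by rw [hWS i hi, one_smul]⟩
    · exact ⟨q⁻¹, hWS' i (Finset.mem_compl.2 hi)⟩
  have hWT : Pairwise fun i j => ⟪W (u i), W (u j)⟫_ℝ = 0 := fun i j hij => by
    obtain ⟨s, hs⟩ := hWc i
    obtain ⟨s', hs'⟩ := hWc j
    rw [hs, hs', real_inner_smul_left, real_inner_smul_right, hT hij, mul_zero, mul_zero]
  have hEY := sum_compl_norm_sq_le u hWT hY ht (fun i hi => by rw [hWS i hi]; exact htS i hi)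
    (fun i hi => by
      rw [hWS' i hi, norm_smul, mul_pow, Real.norm_eq_abs, sq_abs, inv_pow]
      exact (inv_mul_le_iff₀ (by positivity)).2 (htS' i hi))
  have hres : ∑ i ∈ Sᶜ, ‖W (u i)‖ ^ 2 = ∑ i, ‖q⁻¹ • (T - X) (u i)‖ ^ 2 := by
    have h0 : ∑ i ∈ S, ‖q⁻¹ • (T - X) (u i)‖ ^ 2 = 0 := Finset.sum_eq_zero fun i hi => by
      rw [LinearMap.sub_apply, hX, if_pos hi, sub_self, smul_zero, norm_zero, sq, zero_mul]
    rw [← Finset.sum_add_sum_compl S fun i => ‖q⁻¹ • (T - X) (u i)‖ ^ 2, h0, zero_add]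
    refine Finset.sum_congr rfl fun i hi => ?_
    rw [hWS' i hi, LinearMap.sub_apply, hX, if_neg (Finset.mem_compl.1 hi), sub_zero]
  have hexp : ∑ i, ‖(Y - W) (u i)‖ ^ 2 = ∑ i, ‖(Y - X) (u i)‖ ^ 2
      - q⁻¹ * (2 * ∑ i, ⟪(T - X) (u i), (Y - X) (u i)⟫_ℝ)
      + ∑ i, ‖q⁻¹ • (T - X) (u i)‖ ^ 2 := by
    simp only [Finset.mul_sum, ← Finset.sum_sub_distrib, ← Finset.sum_add_distrib]
    refine Finset.sum_congr rfl fun i _ => ?_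
    have : (Y - W) (u i) = (Y - X) (u i) - q⁻¹ • (T - X) (u i) := by
      simp only [hW, LinearMap.sub_apply, LinearMap.add_apply, LinearMap.smul_apply]
      abel
    rw [this, norm_sub_sq_real, real_inner_smul_right, real_inner_comm]
    ring
  rw [hres, hexp] at hEY
  rw [← inv_mul_le_iff₀ hq]
  linarith

end LinearMaps

variable {m n : ℕ}

/-! ### Frobenius scalar product and singular bases -/

/-- The Frobenius scalar product may be computed in any orthonormal basis of the domain. -/
lemma inn_eq_sum_inner (u : OrthonormalBasis (Fin n) ℝ (EuclideanSpace ℝ (Fin n)))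
    (A B : Matrix (Fin m) (Fin n) ℝ) :
    inn A B = ∑ i, ⟪Matrix.toLpLin 2 2 A (u i), Matrix.toLpLin 2 2 B (u i)⟫_ℝ := by
  rw [sum_inner_eq_trace, ← sum_inner_eq_trace (EuclideanSpace.basisFun (Fin n) ℝ), inn_eq_sum]
  refine Finset.sum_congr rfl fun j _ => ?_
  rw [PiLp.inner_apply]
  refine Finset.sum_congr rfl fun i _ => ?_
  simp [Matrix.toLpLin_apply, mul_comm]

lemma inn_self_eq_sum_norm_sq (u : OrthonormalBasis (Fin n) ℝ (EuclideanSpace ℝ (Fin n)))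
    (A : Matrix (Fin m) (Fin n) ℝ) :
    inn A A = ∑ i, ‖Matrix.toLpLin 2 2 A (u i)‖ ^ 2 := by
  simp_rw [inn_eq_sum_inner u, real_inner_self_eq_norm_sq]

lemma rank_eq_finrank_range_toLpLin (A : Matrix (Fin m) (Fin n) ℝ) :
    A.rank = finrank ℝ (LinearMap.range (Matrix.toLpLin 2 2 A)) :=
  A.rank_eq_finrank_range_toLin (PiLp.basisFun 2 ℝ (Fin m)) (PiLp.basisFun 2 ℝ (Fin n))

/-- An orthonormal basis of right singular vectors of `Z`: the eigenvectors of `ZᵀZ`, ordered by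
non-increasing singular value and indexed from `0`. -/
noncomputable def rightSingularBasis (Z : Matrix (Fin m) (Fin n) ℝ) :
    OrthonormalBasis (Fin n) ℝ (EuclideanSpace ℝ (Fin n)) :=
  (Matrix.toLpLin 2 2 Z).isSymmetric_adjoint_comp_self.eigenvectorBasis finrank_euclideanSpace_fin

lemma inner_toLpLin_rightSingularBasis (Z : Matrix (Fin m) (Fin n) ℝ) (i j : Fin n) :
    ⟪Matrix.toLpLin 2 2 Z (rightSingularBasis Z i),
      Matrix.toLpLin 2 2 Z (rightSingularBasis Z j)⟫_ℝ
      = if i = j then (Matrix.toLpLin 2 2 Z).singularValues j ^ 2 else 0 := by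
  set T := Matrix.toLpLin 2 2 Z
  have h := T.isSymmetric_adjoint_comp_self.apply_eigenvectorBasis finrank_euclideanSpace_fin j
  rw [← LinearMap.adjoint_inner_right, ← LinearMap.comp_apply]
  change ⟪rightSingularBasis Z i, (T.adjoint ∘ₗ T)
    (T.isSymmetric_adjoint_comp_self.eigenvectorBasis finrank_euclideanSpace_fin j)⟫_ℝ = _
  rw [h, real_inner_smul_right]
  change _ * ⟪rightSingularBasis Z i, rightSingularBasis Z j⟫_ℝ = _
  rw [(rightSingularBasis Z).inner_eq_ite, ← T.sq_singularValues_fin finrank_euclideanSpace_fin j]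
  split_ifs <;> simp

lemma pairwise_inner_toLpLin_rightSingularBasis (Z : Matrix (Fin m) (Fin n) ℝ) :
    Pairwise fun i j => ⟪Matrix.toLpLin 2 2 Z (rightSingularBasis Z i),
      Matrix.toLpLin 2 2 Z (rightSingularBasis Z j)⟫_ℝ = 0 := fun i j hij =>
  (inner_toLpLin_rightSingularBasis Z i j).trans (if_neg hij)

lemma norm_sq_toLpLin_rightSingularBasis (Z : Matrix (Fin m) (Fin n) ℝ) (i : Fin n) :
    ‖Matrix.toLpLin 2 2 Z (rightSingularBasis Z i)‖ ^ 2 = sv Z (i + 1) ^ 2 := by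
  rw [← real_inner_self_eq_norm_sq, inner_toLpLin_rightSingularBasis, if_pos rfl]
  rfl

lemma sv_nonneg (Z : Matrix (Fin m) (Fin n) ℝ) (i : ℕ) : 0 ≤ sv Z i :=
  LinearMap.singularValues_nonneg _ _

lemma sv_anti (Z : Matrix (Fin m) (Fin n) ℝ) {i j : ℕ} (h : i ≤ j) : sv Z j ≤ sv Z i :=
  LinearMap.singularValues_antitone _ (Nat.sub_le_sub_right h 1)

/-- The first `r` elements of `Fin n` (all of them if `n ≤ r`). -/
def leading (n r : ℕ) : Finset (Fin n) := Finset.univ.filter fun i => i.val < r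

lemma mem_leading {r : ℕ} {i : Fin n} : i ∈ leading n r ↔ i.val < r := by simp [leading]

lemma card_leading {r : ℕ} (h : r ≤ n) : (leading n r).card = r := by
  rw [leading, Fin.card_filter_val_lt, min_eq_right h]

lemma sv_le_norm_sq_of_mem_leading (Z : Matrix (Fin m) (Fin n) ℝ) {r : ℕ} {i : Fin n}
    (hi : i ∈ leading n r) :
    sv Z r ^ 2 ≤ ‖Matrix.toLpLin 2 2 Z (rightSingularBasis Z i)‖ ^ 2 := by
  rw [norm_sq_toLpLin_rightSingularBasis]
  exact pow_le_pow_left₀ (sv_nonneg _ _) (sv_anti Z (mem_leading.1 hi)) 2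

lemma norm_sq_le_sv_of_mem_compl_leading (Z : Matrix (Fin m) (Fin n) ℝ) {r : ℕ} {i : Fin n}
    (hi : i ∈ (leading n r)ᶜ) :
    ‖Matrix.toLpLin 2 2 Z (rightSingularBasis Z i)‖ ^ 2 ≤ sv Z (r + 1) ^ 2 := by
  rw [norm_sq_toLpLin_rightSingularBasis]
  rw [Finset.mem_compl, mem_leading, not_lt] at hi
  exact pow_le_pow_left₀ (sv_nonneg _ _) (sv_anti Z (Nat.succ_le_succ hi)) 2

/-! ### Best approximation and the subdifferential of `G` -/

/-- The **Eckart–Young theorem** for the Frobenius norm: a matrix of rank at most `r` is at squared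
distance at least `∑_{i>r} z_i²` from `Z`. -/
theorem sum_sv_sq_le_inn_sub {r : ℕ} {Y : Matrix (Fin m) (Fin n) ℝ} (hY : Y.rank ≤ r)
    (Z : Matrix (Fin m) (Fin n) ℝ) :
    ∑ i ∈ Finset.Icc (r + 1) (min m n), sv Z i ^ 2 ≤ inn (Y - Z) (Y - Z) := by
  rcases le_or_gt (min m n) r with h | h
  · rw [Finset.Icc_eq_empty (by omega), Finset.sum_empty]
    exact inn_self_nonneg _
  have hr : (leading n r).card = r := card_leading (by omega)
  have hEY := sum_compl_norm_sq_le (rightSingularBasis Z)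
    (pairwise_inner_toLpLin_rightSingularBasis Z) (Y := Matrix.toLpLin 2 2 Y)
    (by rwa [hr, ← rank_eq_finrank_range_toLpLin]) (sq_nonneg (sv Z (r + 1)))
    (fun i hi => (pow_le_pow_left₀ (sv_nonneg _ _) (sv_anti Z r.le_succ) 2).trans
      (sv_le_norm_sq_of_mem_leading Z hi))
    (fun i hi => norm_sq_le_sv_of_mem_compl_leading Z hi)
  rw [inn_self_eq_sum_norm_sq (rightSingularBasis Z), map_sub]
  refine le_trans ?_ hEY
  simp_rw [norm_sq_toLpLin_rightSingularBasis]
  rw [← Finset.sum_image (s := (leading n r)ᶜ) (g := fun i : Fin n => i.val + 1)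
    (f := fun i => sv Z i ^ 2) (fun a _ b _ hab => Fin.ext (by simpa using hab))]
  refine Finset.sum_le_sum_of_subset_of_nonneg (fun i hi => ?_) fun _ _ _ => sq_nonneg _
  rw [Finset.mem_Icc] at hi
  refine Finset.mem_image.2 ⟨⟨i - 1, by omega⟩, ?_, by dsimp only; omega⟩
  rw [Finset.mem_compl, mem_leading]
  dsimp only
  omega

lemma reg_nonpos {r : ℕ} {Y : Matrix (Fin m) (Fin n) ℝ} (hY : Y.rank ≤ r) : reg r Y ≤ 0 :=
  ciSup_le fun Z => by
    rw [fnorm_sq]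
    exact sub_nonpos.2 (sum_sv_sq_le_inn_sub hY Z)

lemma reg_nonneg {r : ℕ} (hr : 1 ≤ r) (X : Matrix (Fin m) (Fin n) ℝ) : 0 ≤ reg r X := by
  refine le_trans ?_ (le_ciSup (bddAbove_reg hr X) X)
  rw [sub_self, fnorm_sq, show inn (0 : Matrix (Fin m) (Fin n) ℝ) 0 = 0 by simp [inn], sub_zero]
  exact Finset.sum_nonneg fun _ _ => sq_nonneg _

/-- Since `reg r` vanishes on matrices of rank at most `r`, a subgradient inequality for `G r` becomes
one for the squared Frobenius norm when tested against such matrices. -/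
lemma inn_self_add_two_mul_le {r : ℕ} (hr : 1 ≤ r) {X Y Z : Matrix (Fin m) (Fin n) ℝ}
    (hY : Y.rank ≤ r) (hZ : (2 : ℝ) • Z ∈ subdiff (G r) X) :
    inn X X + 2 * inn Z (Y - X) ≤ inn Y Y := by
  have h1 := hZ Y
  have h2 := reg_nonneg hr X
  have h3 := reg_nonpos hY
  have h4 : inn ((2 : ℝ) • Z) (Y - X) = 2 * inn Z (Y - X) := by
    simp [inn, Matrix.trace_smul]
  simp only [G, fnorm_sq, h4] at h1
  linarith

/-- The defect `Z - X` of a subgradient, tested against a matrix of rank at most `r`. The factor `1`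
on the right is improved under a singular value gap in `two_mul_inn_sub_le_mul`. -/
lemma two_mul_inn_sub_le {r : ℕ} (hr : 1 ≤ r) {X Y Z : Matrix (Fin m) (Fin n) ℝ}
    (hY : Y.rank ≤ r) (hZ : (2 : ℝ) • Z ∈ subdiff (G r) X) :
    2 * inn (Z - X) (Y - X) ≤ inn (Y - X) (Y - X) := by
  have h := inn_self_add_two_mul_le hr hY hZ
  have h1 : inn (Y - X) (Y - X) - 2 * inn (Z - X) (Y - X)
      = inn Y Y - (inn X X + 2 * inn Z (Y - X)) := by
    simp only [inn_eq_sum, Finset.mul_sum, ← Finset.sum_add_distrib, ← Finset.sum_sub_distrib]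
    refine Finset.sum_congr rfl fun j _ => Finset.sum_congr rfl fun i _ => ?_
    simp only [Matrix.sub_apply]
    ring
  linarith

/-- If `2Z` is a subgradient at `X`, no matrix of rank at most `r` is closer to `Z` than `X`. -/
lemma inn_sub_self_le {r : ℕ} (hr : 1 ≤ r) {X Y Z : Matrix (Fin m) (Fin n) ℝ}
    (hY : Y.rank ≤ r) (hZ : (2 : ℝ) • Z ∈ subdiff (G r) X) :
    inn (X - Z) (X - Z) ≤ inn (Y - Z) (Y - Z) := by
  have h := inn_self_add_two_mul_le hr hY hZ
  have h1 : inn (Y - Z) (Y - Z) - inn (X - Z) (X - Z)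
      = inn Y Y - (inn X X + 2 * inn Z (Y - X)) := by
    simp only [inn_eq_sum, Finset.mul_sum, ← Finset.sum_add_distrib, ← Finset.sum_sub_distrib]
    refine Finset.sum_congr rfl fun j _ => Finset.sum_congr rfl fun i _ => ?_
    simp only [Matrix.sub_apply]
    ring
  linarith

/-- With a gap after the `r`-th singular value, a base point `X` of rank at most `r` of the subgradient
`2Z` is the truncated singular value decomposition of `Z`. -/
lemma toLpLin_eq_of_mem_subdiff {r : ℕ} (hr : 1 ≤ r) (hrn : r ≤ n)
    {X Z : Matrix (Fin m) (Fin n) ℝ} (hX : X.rank ≤ r) (hZ : (2 : ℝ) • Z ∈ subdiff (G r) X)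
    (hgap : sv Z (r + 1) < sv Z r) (i : Fin n) :
    Matrix.toLpLin 2 2 X (rightSingularBasis Z i)
      = if i ∈ leading n r then Matrix.toLpLin 2 2 Z (rightSingularBasis Z i) else 0 := by
  set u := rightSingularBasis Z
  set T := Matrix.toLpLin 2 2 Z
  have hS : (leading n r).card = r := card_leading hrn
  refine apply_eq_of_sum_norm_sq_le u (pairwise_inner_toLpLin_rightSingularBasis Z)
    (by rwa [hS, ← rank_eq_finrank_range_toLpLin]) (sq_nonneg (sv Z (r + 1)))
    (pow_lt_pow_left₀ hgap (sv_nonneg _ _) two_ne_zero)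
    (fun i hi => sv_le_norm_sq_of_mem_leading Z hi)
    (fun i hi => norm_sq_le_sv_of_mem_compl_leading Z hi) ?_ i
  have hY : ((Matrix.toLpLin 2 2).symm (truncate u T (leading n r))).rank ≤ r := by
    rw [rank_eq_finrank_range_toLpLin, LinearEquiv.apply_symm_apply]
    exact (finrank_range_truncate_le _ _ _).trans hS.le
  have h := inn_sub_self_le hr hY hZ
  rwa [inn_self_eq_sum_norm_sq u, inn_self_eq_sum_norm_sq u, map_sub, map_sub,
    LinearEquiv.apply_symm_apply, sum_norm_sq_truncate_sub] at h

lemma two_mul_inn_sub_le_mul {r : ℕ} (hr : 1 ≤ r) {X Y Z : Matrix (Fin m) (Fin n) ℝ}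
    (hrn : r ≤ n) (hX : X.rank ≤ r) (hY : Y.rank ≤ r) (hZ : (2 : ℝ) • Z ∈ subdiff (G r) X)
    (hgap : sv Z (r + 1) < sv Z r) {q : ℝ} (hq : 0 < q) (hqZ : sv Z (r + 1) ≤ q * sv Z r) :
    2 * inn (Z - X) (Y - X) ≤ q * inn (Y - X) (Y - X) := by
  have h := two_mul_sum_inner_le (rightSingularBasis Z)
    (pairwise_inner_toLpLin_rightSingularBasis Z)
    (toLpLin_eq_of_mem_subdiff hr hrn hX hZ hgap) (Y := Matrix.toLpLin 2 2 Y)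
    (by rwa [card_leading hrn, ← rank_eq_finrank_range_toLpLin]) (sq_nonneg (sv Z r)) hq
    (fun i hi => sv_le_norm_sq_of_mem_leading Z hi)
    (fun i hi => (norm_sq_le_sv_of_mem_compl_leading Z hi).trans (by
      rw [← mul_pow]
      exact pow_le_pow_left₀ (sv_nonneg _ _) hqZ 2))
  rwa [inn_eq_sum_inner (rightSingularBasis Z), inn_self_eq_sum_norm_sq (rightSingularBasis Z),
    map_sub, map_sub]

lemma inn_self_pos {X : Matrix (Fin m) (Fin n) ℝ} (hX : X ≠ 0) : 0 < inn X X := by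
  refine (inn_self_nonneg X).lt_of_ne' fun h => hX ?_
  rw [inn, ← Matrix.conjTranspose_eq_transpose_of_trivial] at h
  exact Matrix.trace_conjTranspose_mul_self_eq_zero_iff.1 h

end FixedRank

theorem corollary1 {m n r : ℕ} (hr : 1 ≤ r) {c : ℝ} (hc0 : 0 < c) (hc1 : c < 1)
    (X Z : Matrix (Fin m) (Fin n) ℝ) (hX : X.rank = r)
    (hZ : (2 : ℝ) • Z ∈ FixedRank.subdiff (FixedRank.G r) X)
    (hgap : FixedRank.sv Z (r + 1) < c * FixedRank.sv Z r) :
    ∀ X' Z' : Matrix (Fin m) (Fin n) ℝ, X'.rank ≤ r → X' ≠ X →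
      (2 : ℝ) • Z' ∈ FixedRank.subdiff (FixedRank.G r) X' →
        FixedRank.inn (Z' - Z) (X' - X) > (1 - c) / 2 * FixedRank.fnorm (X' - X) ^ 2 := by
  intro X' Z' hX' hne hZ'
  have hrn : r ≤ n := hX ▸ X.rank_le_width
  have h0 := FixedRank.sv_nonneg Z (r + 1)
  have hpos : 0 < FixedRank.sv Z r := pos_of_mul_pos_right (h0.trans_lt hgap) hc0.le
  -- A `q` strictly between `z_{r+1} / z_r` and `c` makes the final inequality strict.
  obtain ⟨q, hqZ, hqc⟩ := exists_between ((div_lt_iff₀ hpos).2 hgap)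
  have hq : 0 < q := (div_nonneg h0 hpos.le).trans_lt hqZ
  have hgap' : FixedRank.sv Z (r + 1) < FixedRank.sv Z r :=
    hgap.trans (mul_lt_of_lt_one_left hpos hc1)
  have h1 := FixedRank.two_mul_inn_sub_le_mul hr hrn hX.le hX' hZ hgap' hq
    ((div_le_iff₀ hpos).1 hqZ.le)
  have h2 := FixedRank.two_mul_inn_sub_le hr hX.le hZ'
  have h3 : FixedRank.inn (X - X') (X - X') = FixedRank.inn (X' - X) (X' - X) := by
    rw [← neg_sub X' X]
    simp only [FixedRank.inn, Matrix.transpose_neg, Matrix.neg_mul, Matrix.mul_neg, neg_neg]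
  have h4 : FixedRank.inn (Z' - Z) (X' - X) = FixedRank.inn (X' - X) (X' - X)
      - FixedRank.inn (Z' - X') (X - X') - FixedRank.inn (Z - X) (X' - X) := by
    rw [← neg_sub X' X]
    simp only [FixedRank.inn, Matrix.transpose_sub, Matrix.sub_mul, Matrix.mul_neg,
      Matrix.trace_sub, Matrix.trace_neg]
    ring
  have h5 : q * FixedRank.inn (X' - X) (X' - X) < c * FixedRank.inn (X' - X) (X' - X) :=
    mul_lt_mul_of_pos_right hqc (FixedRank.inn_self_pos (sub_ne_zero.2 hne))
  rw [FixedRank.fnorm_sq, h4]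
  linarith
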